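/- Let $H$ be a real Hilbert space, let $k\ge 0$ be an integer, and let $(V_j)_{j\in\mathbb{N}}$ be a sequence of closed subspaces of $H$, each of codimension $k$. A $k$-dimensional subspace $C\subset H$ with $H=V_j\oplus C$ for all $j$ is called a well-separating common complement of $(V_j)$ if there are real numbers $\delta_j>0$ with $\lim_{j\to\infty}\frac1j\log\delta_j=0$ such that $$\inf_{x\in C,\ \|x\|=1} d(x,V_j)\ \ge\ \delta_j\qquad\text{for all } j\in\mathbb{N}$$ (an infimum over the empty set is $+\infty$). A subset $F$ of a Banach space $X$ is called prevalent if it contains a Borel set $E$ for which there is a Borel measure $\mu$ on $X$ such that $0<\mu(K)<\infty$ for some compact $K\subset X$ and $\mu(X\setminus(E+x))=0$ for all $x\in X$. A finite-dimensional subspace $P\subset X$ is called a probe for $F$ if there is a Borel set $E\subset F$ such that, for every $x\in X$, the set $P\setminus(E+x)$ has Lebesgue measure zero in $P$ (where $P$ is identified with a Euclidean space by a choice of basis). Theorem. The set of all $(x_1,\dots,x_k)\in H^k$ such that $\operatorname{span}(x_1,\dots,x_k)$ is a well-separating common complement of $(V_j)_{j\in\mathbb{N}}$ is prevalent in $H^k$.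 Moreover, there is a (finite-dimensional) probe for this set. -/

import Mathlib

open MeasureTheory Filter Topology
open scoped ENNReal

namespace WellSep

section Grassmannians

variable {X : Type*} [NormedAddCommGroup X] [NormedSpace ℝ X]

/-- The set of `k`-dimensional subspaces of `X`. The dimension is the cardinal rank, so that
`k = 0` does not include infinite-dimensional subspaces. -/
def subspacesOfDim (X : Type*) [NormedAddCommGroup X] [NormedSpace ℝ X] (k : ℕ) :
    Set (Submodule ℝ X) :=
  {C | Module.rank ℝ C = k}

/-- The set of closed subspaces of `X` of codimension `k`. -/
def closedSubspacesOfCodim (X : Type*) [NormedAddCommGroup X] [NormedSpace ℝ X] (k : ℕ) :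
    Set (Submodule ℝ X) :=
  {V | IsClosed (V : Set X) ∧ Module.rank ℝ (X ⧸ V) = k}

/-- The degree of transversality `inf {d(x, V) | x ∈ C, ‖x‖ = 1}`. The infimum is taken in
`[0, ∞]`, so it is `∞` when `C = 0`. -/
noncomputable def degreeOfTransversality (V C : Submodule ℝ X) : ℝ≥0∞ :=
  ⨅ x ∈ {x : X | x ∈ C ∧ ‖x‖ = 1}, Metric.infEDist x (V : Set X)

/-- `C` is a `k`-dimensional common complement of all the `V j`. -/
def IsCommonComplement (k : ℕ) (V : ℕ → Submodule ℝ X) (C : Submodule ℝ X) : Prop :=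
  C ∈ subspacesOfDim X k ∧ ∀ j, IsCompl (V j) C

/-- `C` is `δ`-separating: the degree of transversality to `V j` is at least `δ j`. -/
def IsSeparating (δ : ℕ → ℝ) (V : ℕ → Submodule ℝ X) (C : Submodule ℝ X) : Prop :=
  ∀ j, ENNReal.ofReal (δ j) ≤ degreeOfTransversality (V j) C

/-- `C` is a well-separating common complement of the `V j`: it is a common complement that is
`δ`-separating for some positive sequence `δ` with `(1 / j) * log (δ j) → 0`. -/
def IsWellSeparatingCommonComplement (k : ℕ) (V : ℕ → Submodule ℝ X) (C : Submodule ℝ X) :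
    Prop :=
  IsCommonComplement k V C ∧
    ∃ δ : ℕ → ℝ, (∀ j, 0 < δ j) ∧ IsSeparating δ V C ∧
      Tendsto (fun j : ℕ => 1 / (j : ℝ) * Real.log (δ j)) atTop (𝓝 0)

end Grassmannians

section Prevalence

variable {X : Type*} [NormedAddCommGroup X] [NormedSpace ℝ X]

/-- `F` is prevalent: it contains a Borel set `E` for which there is a Borel measure `μ`, positive
and finite on some compact set, such that every translate `E + x` has full `μ`-measure.
The Borel σ-algebra is used explicitly, because on a finite power of a nonseparable space it can
be larger than the product σ-algebra. -/
def IsPrevalent (F : Set X) : Prop :=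
  letI : MeasurableSpace X := borel X
  ∃ E : Set X, MeasurableSet E ∧ E ⊆ F ∧
    ∃ μ : Measure X,
      (∃ K : Set X, IsCompact K ∧ 0 < μ K ∧ μ K < ∞) ∧
      ∀ x : X, μ ((fun y => y + x) '' E)ᶜ = 0

/-- The parametrization of a subspace `P` of finite dimension `n` by `ℝⁿ` through a basis. -/
noncomputable def probeParam (P : Submodule ℝ X) [FiniteDimensional ℝ P] :
    (Fin (Module.finrank ℝ P) → ℝ) →ₗ[ℝ] X :=
  P.subtype ∘ₗ (Module.finBasis ℝ P).equivFun.symm.toLinearMap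

/-- Lebesgue measure of the finite-dimensional subspace `P`, as a Borel measure on `X`
(it gives to `A` the Lebesgue measure of `A ∩ P`; another basis only rescales it). -/
noncomputable def probeMeasure (P : Submodule ℝ X) [FiniteDimensional ℝ P] :
    @Measure X (borel X) :=
  letI : MeasurableSpace X := borel X
  Measure.map (probeParam P) volume

/-- `probeMeasure` is a push-forward along a Borel measurable map, hence has the expected values. -/
theorem probeMeasure_apply (P : Submodule ℝ X) [FiniteDimensional ℝ P] {A : Set X}
    (hA : MeasurableSet[borel X] A) :
    probeMeasure P A = volume (probeParam P ⁻¹' A) := by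
  let _ : MeasurableSpace X := borel X
  have : BorelSpace X := ⟨rfl⟩
  exact Measure.map_apply (probeParam P).continuous_of_finiteDimensional.measurable hA

/-- The finite-dimensional subspace `P` is a probe for `F`: there is a Borel set `E ⊆ F` all of
whose translates have full measure for the Lebesgue measure of `P`. -/
def IsProbe (P : Submodule ℝ X) [FiniteDimensional ℝ P] (F : Set X) : Prop :=
  ∃ E : Set X, MeasurableSet[borel X] E ∧ E ⊆ F ∧
    ∀ x : X, probeMeasure P ((fun y => y + x) '' E)ᶜ = 0

end Prevalence

end WellSep

/-! Write each `V j` as the common kernel of an orthonormal family `w j` and let `M j x` be the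
matrix of the ⟨w j i, x l⟩. If det `M j x` ≠ 0, then span x is a complement of `V j`, and by
Cramer's rule |det `M j x`| bounds the transversality from below up to a factor depending only on x.
So it suffices that these determinants never vanish and decay at most polynomially in j. Along a
line x + t c, the determinant is det `M j c` times a monic polynomial of degree k in t. Such a
polynomial is below ε^k only on a set of measure at most 2kε, whatever x is. Borel–Cantelli with ε =
(j + 1)⁻² then shows that almost every t is good, so ℝc is a probe as soon as c itself has
polynomially bounded determinants. Such a c is found by the same argument: in ∑ tₙ wₙ / (n + 1)²
with independent uniform tₙ, varying tₙ alone moves along a line whose direction has determinant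
exactly (n + 1)^(-2k) against wₙ. -/

namespace WellSep

/-! ### Sublevel sets of determinants along lines -/

section SmallDeterminants

open Polynomial in
/-- If a monic real polynomial of degree `k` is smaller than `ε ^ k` at `t`, then `t` is `ε`-close
to the real part of one of its complex roots. -/
theorem exists_root_near_of_abs_eval_lt {p : ℝ[X]} (hp : p.Monic) {ε t : ℝ} (hε : 0 ≤ ε)
    (h : |p.eval t| < ε ^ p.natDegree) :
    ∃ z ∈ (p.map (algebraMap ℝ ℂ)).roots, t ∈ Metric.ball z.re ε := by
  by_contra! hz
  have hs := IsAlgClosed.splits (p.map (algebraMap ℝ ℂ))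
  have heval : ((p.eval t : ℝ) : ℂ)
      = ((p.map (algebraMap ℝ ℂ)).roots.map fun a => (t : ℂ) - a).prod := by
    rw [← hs.eval_eq_prod_roots_of_monic (hp.map _)]
    exact (eval_map_algebraMap p (t : ℂ)).trans (aeval_algebraMap_apply ℂ t p) |>.symm
  have hnorm : |p.eval t|
      = ((p.map (algebraMap ℝ ℂ)).roots.map fun a => ‖(t : ℂ) - a‖).prod := by
    rw [← Real.norm_eq_abs, ← Complex.norm_real, heval]
    exact (map_multiset_prod (normHom : ℂ →*₀ ℝ) _).trans (by rw [Multiset.map_map]; rfl)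
  have hcard : (p.map (algebraMap ℝ ℂ)).roots.card = p.natDegree := by
    rw [← hs.natDegree_eq_card_roots, natDegree_map]
  refine absurd h (not_lt.mpr ?_)
  rw [hnorm, ← hcard, ← Multiset.prod_replicate, ← Multiset.map_const']
  -- Each of the k factors |t - z| is at least |t - Re z| ≥ ε.
  refine Multiset.prod_map_le_prod_map₀ _ _ (fun _ _ => hε) fun z hzm => ?_
  have h1 := hz z hzm
  rw [Metric.mem_ball, not_lt, Real.dist_eq] at h1
  refine h1.trans ?_
  simpa using Complex.abs_re_le_norm ((t : ℂ) - z)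

open Polynomial in
/-- The sublevel sets of a monic real polynomial are small, uniformly in the polynomial. -/
theorem volume_abs_eval_lt_le {p : ℝ[X]} (hp : p.Monic) {ε : ℝ} (hε : 0 ≤ ε) :
    volume {t : ℝ | |p.eval t| < ε ^ p.natDegree}
      ≤ ENNReal.ofReal (2 * p.natDegree * ε) := by
  classical
  set R := (p.map (algebraMap ℝ ℂ)).roots
  have hsub : {t : ℝ | |p.eval t| < ε ^ p.natDegree}
      ⊆ ⋃ z ∈ R.toFinset, Metric.ball z.re ε := by
    intro t ht
    obtain ⟨z, hz, hzt⟩ := exists_root_near_of_abs_eval_lt hp hε ht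
    simp only [Set.mem_iUnion]
    exact ⟨z, Multiset.mem_toFinset.2 hz, hzt⟩
  have hcard : (R.toFinset.card : ℝ) ≤ p.natDegree := by
    have h1 : R.card ≤ (p.map (algebraMap ℝ ℂ)).natDegree := card_roots' _
    rw [natDegree_map] at h1
    exact_mod_cast (Multiset.toFinset_card_le R).trans h1
  calc volume {t : ℝ | |p.eval t| < ε ^ p.natDegree}
      ≤ ∑ z ∈ R.toFinset, volume (Metric.ball z.re ε) :=
        (measure_mono hsub).trans (measure_biUnion_finset_le _ _)
    _ = ENNReal.ofReal (R.toFinset.card * (2 * ε)) := by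
        rw [ENNReal.ofReal_mul (Nat.cast_nonneg _), ENNReal.ofReal_natCast]
        simp only [Real.volume_ball, Finset.sum_const, nsmul_eq_mul]
    _ ≤ _ := ENNReal.ofReal_le_ofReal (by nlinarith)

/-- Along the line `A + t B`, the determinant is rarely much smaller than `det B`, uniformly
in `A`. -/
theorem volume_abs_det_add_smul_lt_le {k : ℕ} (A B : Matrix (Fin k) (Fin k) ℝ) {ε : ℝ}
    (hε : 0 ≤ ε) :
    volume {t : ℝ | |(A + t • B).det| < |B.det| * ε ^ k} ≤ ENNReal.ofReal (2 * k * ε) := by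
  by_cases hB : B.det = 0
  · have : {t : ℝ | |(A + t • B).det| < |B.det| * ε ^ k} = ∅ := by
      ext t
      simp [hB]
    simp [this]
  have hBu : IsUnit B.det := isUnit_iff_ne_zero.2 hB
  have hdeg : (-(B⁻¹ * A)).charpoly.natDegree = k := by simp
  have h := volume_abs_eval_lt_le (Matrix.charpoly_monic (-(B⁻¹ * A))) hε
  rw [hdeg] at h
  refine le_trans (measure_mono fun t ht => ?_) h
  -- Factoring out `B` leaves the characteristic polynomial of -B⁻¹A, which is monic.
  have hfac : A + t • B = B * (Matrix.scalar (Fin k) t - -(B⁻¹ * A)) := by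
    rw [sub_neg_eq_add, mul_add, ← mul_assoc, Matrix.mul_nonsing_inv _ hBu, one_mul, add_comm,
      Matrix.scalar_apply, ← Matrix.smul_one_eq_diagonal, mul_smul_comm, mul_one]
  rw [Set.mem_ofPred_eq, hfac, Matrix.det_mul, abs_mul] at ht
  rw [Set.mem_ofPred_eq, Matrix.eval_charpoly]
  exact lt_of_mul_lt_mul_left ht (abs_nonneg _)

/-- A Borel–Cantelli argument: functions with small sublevel sets are almost surely nonzero, and
eventually bounded below by an inverse power. -/
theorem ae_ne_zero_and_eventually_le {Ω : Type*} [MeasurableSpace Ω] (μ : Measure Ω) {k m n : ℕ}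
    (hn : 2 * k + m ≤ n)
    {f : ℕ → Ω → ℝ} {ρ : ℕ → ℝ} (hρ : ∀ j, 0 < ρ j)
    (hρm : ∀ᶠ j : ℕ in atTop, (((j : ℝ) + 1) ^ m)⁻¹ ≤ ρ j) {C : ℝ}
    (hf : ∀ j, ∀ ε > 0, μ {ω | |f j ω| < ρ j * ε ^ k} ≤ ENNReal.ofReal (C * ε)) :
    ∀ᵐ ω ∂μ, (∀ j, f j ω ≠ 0) ∧ ∀ᶠ j : ℕ in atTop, (((j : ℝ) + 1) ^ n)⁻¹ ≤ |f j ω| := by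
  have h0 : ∀ᵐ ω ∂μ, ∀ j, f j ω ≠ 0 := by
    refine ae_all_iff.2 fun j => ?_
    have hlim : Tendsto (fun ε : ℝ => ENNReal.ofReal (C * ε)) (𝓝[>] 0) (𝓝 0) := by
      have : Tendsto (fun ε : ℝ => ENNReal.ofReal (C * ε)) (𝓝 0) (𝓝 (ENNReal.ofReal (C * 0))) :=
        ENNReal.tendsto_ofReal (tendsto_id.const_mul C)
      simpa using this.mono_left nhdsWithin_le_nhds
    refine le_antisymm (ge_of_tendsto hlim ?_) zero_le
    filter_upwards [self_mem_nhdsWithin] with ε hε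
    refine (measure_mono fun ω hω => ?_).trans (hf j ε hε)
    have hω0 : f j ω = 0 := by simpa using hω
    simpa [hω0] using mul_pos (hρ j) (pow_pos hε k)
  -- ε = (j + 1)⁻² is summable and costs a factor (j + 1)^(-2k), whence `2 * k + m ≤ n`.
  have hsum : ∑' j, μ {ω | |f j ω| < ρ j * ((((j : ℝ) + 1) ^ 2)⁻¹) ^ k} ≠ ∞ := by
    refine ne_top_of_le_ne_top (b := ∑' j : ℕ, ENNReal.ofReal (C * (((j : ℝ) + 1) ^ 2)⁻¹)) ?_
      (ENNReal.tsum_le_tsum fun j => hf j _ (by positivity))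
    have hs : Summable fun j : ℕ => C * (((j : ℝ) + 1) ^ 2)⁻¹ := by
      have := (summable_nat_add_iff 1).2 (Real.summable_nat_pow_inv.2 one_lt_two)
      exact (by simpa using this : Summable fun j : ℕ => (((j : ℝ) + 1) ^ 2)⁻¹).mul_left C
    exact hs.tsum_ofReal_ne_top
  filter_upwards [h0, ae_eventually_notMem hsum] with ω h1 h2
  refine ⟨h1, ?_⟩
  filter_upwards [h2, hρm] with j hj hjm
  rw [not_lt] at hj
  refine le_trans ?_ hj
  have hj1 : (1 : ℝ) ≤ (j : ℝ) + 1 := by simp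
  calc (((j : ℝ) + 1) ^ n)⁻¹ ≤ (((j : ℝ) + 1) ^ (m + 2 * k))⁻¹ := by
        gcongr
        omega
    _ = (((j : ℝ) + 1) ^ m)⁻¹ * ((((j : ℝ) + 1) ^ 2)⁻¹) ^ k := by
        rw [pow_add, mul_inv, pow_mul, inv_pow _ k]
    _ ≤ _ := by gcongr

end SmallDeterminants

/-! ### Pairing determinants and transversality -/

section Gram

variable {H : Type*} [NormedAddCommGroup H] [InnerProductSpace ℝ H] {k : ℕ}

/-- The matrix of inner products of two finite families. -/
noncomputable def pairingMatrix (w x : Fin k → H) : Matrix (Fin k) (Fin k) ℝ :=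
  Matrix.of fun i l => inner ℝ (w i) (x l)

theorem pairingMatrix_apply (w x : Fin k → H) (i l : Fin k) :
    pairingMatrix w x i l = inner ℝ (w i) (x l) := rfl

theorem pairingMatrix_add_smul (w x y : Fin k → H) (t : ℝ) :
    pairingMatrix w (x + t • y) = pairingMatrix w x + t • pairingMatrix w y := by
  ext i l
  simp [pairingMatrix_apply, inner_add_right, inner_smul_right]

theorem pairingMatrix_smul (w x : Fin k → H) (t : ℝ) :
    pairingMatrix w (t • x) = t • pairingMatrix w x := by
  ext i l
  simp [pairingMatrix_apply, inner_smul_right]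

theorem pairingMatrix_self {w : Fin k → H} (hw : Orthonormal ℝ w) : pairingMatrix w w = 1 := by
  ext i l
  rw [pairingMatrix_apply, orthonormal_iff_ite.1 hw, Matrix.one_apply]

theorem continuous_det_pairingMatrix (w : Fin k → H) :
    Continuous fun x : Fin k → H => (pairingMatrix w x).det := by
  refine Continuous.matrix_det (continuous_matrix fun i l => ?_)
  simp only [pairingMatrix_apply]
  fun_prop

theorem pairingMatrix_mulVec (w x : Fin k → H) (a : Fin k → ℝ) (i : Fin k) :
    (pairingMatrix w x).mulVec a i = inner ℝ (w i) (∑ l, a l • x l) := by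
  simp [Matrix.mulVec, dotProduct, pairingMatrix_apply, inner_sum, inner_smul_right, mul_comm]

/-- A closed subspace of codimension `k` is cut out by an orthonormal family of `k` vectors. -/
theorem exists_orthonormal_of_mem_closedSubspacesOfCodim [CompleteSpace H] {V : Submodule ℝ H}
    (hV : V ∈ closedSubspacesOfCodim H k) :
    ∃ w : Fin k → H, Orthonormal ℝ w ∧ ∀ v, v ∈ V ↔ ∀ i, inner ℝ (w i) v = 0 := by
  obtain ⟨hc, hr⟩ := hV
  have : CompleteSpace V := hc.completeSpace_coe
  have hr' : Module.rank ℝ Vᗮ = k := by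
    rw [← hr]
    exact V.quotientEquivOrthogonal.toLinearEquiv.rank_eq.symm
  have hfin : FiniteDimensional ℝ Vᗮ :=
    Module.rank_lt_aleph0_iff.1 (hr' ▸ Cardinal.natCast_lt_aleph0)
  let b := (stdOrthonormalBasis ℝ Vᗮ).reindex (finCongr (Module.finrank_eq_of_rank_eq hr'))
  refine ⟨fun i => b i, b.orthonormal.comp_linearIsometry Vᗮ.subtypeₗᵢ, fun v => ⟨fun hv i => ?_,
    fun hv => ?_⟩⟩
  · exact Submodule.inner_left_of_mem_orthogonal hv (b i).2
  · rw [← Submodule.orthogonal_orthogonal V, Submodule.mem_orthogonal]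
    intro u hu
    have h := b.sum_repr ⟨u, hu⟩
    have h' : ∑ i, b.repr ⟨u, hu⟩ i • (b i : H) = u := by
      simpa using congrArg (Subtype.val) h
    rw [← h', sum_inner]
    exact Finset.sum_eq_zero fun i _ => by rw [real_inner_smul_left, hv i, mul_zero]

variable {V : Submodule ℝ H} {w x : Fin k → H}

theorem linearIndependent_of_det_pairingMatrix_ne_zero (h : (pairingMatrix w x).det ≠ 0) :
    LinearIndependent ℝ x := by
  rw [Fintype.linearIndependent_iff]
  intro a ha
  have h0 : (pairingMatrix w x).mulVec a = 0 := by
    ext i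
    rw [pairingMatrix_mulVec, ha, inner_zero_right, Pi.zero_apply]
  exact congrFun (Matrix.eq_zero_of_mulVec_eq_zero h h0)

/-- Injectivity of the matrix gives trivial intersection. Solving for coefficients `a` with the same
pairings as `y` puts `y - ∑ l, a l • x l` in `V`. -/
theorem isCompl_span_of_det_pairingMatrix_ne_zero (hV : ∀ v, v ∈ V ↔ ∀ i, inner ℝ (w i) v = 0)
    (h : (pairingMatrix w x).det ≠ 0) : IsCompl V (Submodule.span ℝ (Set.range x)) := by
  constructor
  · rw [Submodule.disjoint_def]
    intro y hyV hy
    obtain ⟨a, rfl⟩ := (Submodule.mem_span_range_iff_exists_fun ℝ).1 hy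
    have h0 : (pairingMatrix w x).mulVec a = 0 := by
      ext i
      rw [pairingMatrix_mulVec, (hV _).1 hyV, Pi.zero_apply]
    simp [Matrix.eq_zero_of_mulVec_eq_zero h h0]
  · rw [codisjoint_iff, Submodule.eq_top_iff']
    intro y
    let a := (pairingMatrix w x)⁻¹.mulVec fun i => inner ℝ (w i) y
    have ha : (pairingMatrix w x).mulVec a = fun i => inner ℝ (w i) y := by
      rw [Matrix.mulVec_mulVec, Matrix.mul_nonsing_inv _ (isUnit_iff_ne_zero.2 h),
        Matrix.one_mulVec]
    rw [← sub_add_cancel y (∑ l, a l • x l)]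
    refine Submodule.add_mem_sup ((hV _).2 fun i => ?_)
      ((Submodule.mem_span_range_iff_exists_fun ℝ).2 ⟨a, rfl⟩)
    rw [inner_sub_right, ← pairingMatrix_mulVec, ha, sub_self]

/-- The determinant of the pairing of `x` with orthonormal equations of `V` bounds the degree of
transversality of `V` and the span of `x` from below, uniformly in `V`. -/
theorem exists_abs_det_pairingMatrix_le (x : Fin k → H) :
    ∃ K > 0, ∀ (V : Submodule ℝ H) (w : Fin k → H), Orthonormal ℝ w →
      (∀ v, v ∈ V ↔ ∀ i, inner ℝ (w i) v = 0) →
      ENNReal.ofReal (|(pairingMatrix w x).det| / K)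
        ≤ degreeOfTransversality V (Submodule.span ℝ (Set.range x)) := by
  set R : ℝ := max ‖x‖ 1
  -- Leibniz bound for the adjugate entries, which are determinants with one row replaced by a unit
  -- vector; hence `R ≥ 1`.
  set D : ℝ := k.factorial * R ^ k
  -- The summand 1 keeps the constant positive when `k = 0` or `x = 0`.
  refine ⟨1 + k * (k * D * ‖x‖), by positivity, fun V w hw hV => ?_⟩
  set M := pairingMatrix w x
  have hentry : ∀ i l, |M i l| ≤ R := fun i l => by
    refine (abs_real_inner_le_norm _ _).trans ?_
    rw [hw.1 i, one_mul]
    exact (norm_le_pi_norm x l).trans (le_max_left _ _)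
  have hadj : ∀ l i, |M.adjugate l i| ≤ D := fun l i => by
    rw [Matrix.adjugate_apply]
    refine (Matrix.det_le (abv := AbsoluteValue.abs) (x := R) fun p q => ?_).trans (by simp [D])
    rw [AbsoluteValue.abs_apply, Matrix.updateRow_apply]
    split_ifs with hp
    · rw [Pi.single_apply]
      split_ifs <;> simp [R]
    · exact hentry p q
  refine le_iInf₂ fun y hy => ?_
  obtain ⟨hy, hy1⟩ := hy
  refine Metric.le_infEDist.2 fun v hv => ?_
  rw [edist_dist, dist_eq_norm]
  refine ENNReal.ofReal_le_ofReal ?_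
  rw [div_le_iff₀' (by positivity)]
  obtain ⟨a, rfl⟩ := (Submodule.mem_span_range_iff_exists_fun ℝ).1 hy
  set y := ∑ l, a l • x l
  have hMa : ∀ i, |M.mulVec a i| ≤ ‖y - v‖ := fun i => by
    rw [pairingMatrix_mulVec, ← sub_zero (inner ℝ (w i) _), ← (hV v).1 hv i, ← inner_sub_right]
    refine (abs_real_inner_le_norm _ _).trans ?_
    rw [hw.1 i, one_mul]
  have ha : ∀ l, |M.det| * |a l| ≤ k * D * ‖y - v‖ := fun l => by
    have h1 : M.det * a l = M.adjugate.mulVec (M.mulVec a) l := by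
      rw [Matrix.mulVec_mulVec, Matrix.adjugate_mul, Matrix.smul_mulVec, Matrix.one_mulVec,
        Pi.smul_apply, smul_eq_mul]
    rw [← abs_mul, h1]
    calc |M.adjugate.mulVec (M.mulVec a) l|
        ≤ ∑ i, |M.adjugate l i * M.mulVec a i| :=
          Finset.abs_sum_le_sum_abs (fun i => M.adjugate l i * M.mulVec a i) Finset.univ
      _ ≤ ∑ _i : Fin k, D * ‖y - v‖ := by
          refine Finset.sum_le_sum fun i _ => ?_
          rw [abs_mul]
          exact mul_le_mul (hadj l i) (hMa i) (abs_nonneg _) (by positivity)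
      _ = _ := by simp [mul_assoc]
  calc |M.det| = |M.det| * ‖y‖ := by rw [hy1, mul_one]
    _ ≤ |M.det| * ∑ l, |a l| * ‖x‖ := by
        gcongr
        refine (norm_sum_le _ _).trans (Finset.sum_le_sum fun l _ => ?_)
        rw [norm_smul, Real.norm_eq_abs]
        gcongr
        exact norm_le_pi_norm x l
    _ = ∑ l, |M.det| * |a l| * ‖x‖ := by simp only [Finset.mul_sum, mul_assoc]
    _ ≤ ∑ _l : Fin k, k * D * ‖y - v‖ * ‖x‖ := by
        exact Finset.sum_le_sum fun l _ => mul_le_mul_of_nonneg_right (ha l) (norm_nonneg x)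
    _ = k * (k * D * ‖x‖) * ‖y - v‖ := by
        rw [Finset.sum_const, Finset.card_univ, Fintype.card_fin, nsmul_eq_mul]
        ring
    _ ≤ (1 + k * (k * D * ‖x‖)) * ‖y - v‖ := by
        gcongr
        linarith

/-- Inverse powers decay subexponentially. -/
theorem tendsto_log_inv_pow_div {K : ℝ} (hK : 0 < K) (n : ℕ) :
    Tendsto (fun j : ℕ => 1 / (j : ℝ) * Real.log ((((j : ℝ) + 1) ^ n)⁻¹ / K)) atTop (𝓝 0) := by
  have h1 : Tendsto (fun j : ℕ => Real.log ((j : ℝ) + 1) / ((j : ℝ) + 1)) atTop (𝓝 0) :=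
    (Real.isLittleO_log_id_atTop.tendsto_div_nhds_zero).comp
      (tendsto_natCast_atTop_atTop.atTop_add tendsto_const_nhds)
  have h2 : Tendsto (fun j : ℕ => 1 / (j : ℝ)) atTop (𝓝 0) := tendsto_one_div_atTop_nhds_zero_nat
  have h3 : Tendsto (fun j : ℕ => -(n * (Real.log ((j : ℝ) + 1) / ((j : ℝ) + 1)
      * (1 + 1 / (j : ℝ)))) - 1 / (j : ℝ) * Real.log K) atTop (𝓝 0) := by
    simpa using (((h1.mul (h2.const_add 1)).const_mul (n : ℝ)).neg).sub (h2.mul_const (Real.log K))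
  refine h3.congr' ?_
  filter_upwards [eventually_gt_atTop 0] with j hj
  have hj' : (0 : ℝ) < j := Nat.cast_pos.2 hj
  rw [Real.log_div (by positivity) hK.ne', Real.log_inv, Real.log_pow]
  field_simp

/-- A determinant criterion for well-separating common complements. -/
theorem isWellSeparatingCommonComplement_span {V : ℕ → Submodule ℝ H} {w : ℕ → Fin k → H}
    (hw : ∀ j, Orthonormal ℝ (w j)) (hV : ∀ j v, v ∈ V j ↔ ∀ i, inner ℝ (w j i) v = 0)
    (h : ∀ j, (pairingMatrix (w j) x).det ≠ 0) {n : ℕ}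
    (hn : ∀ᶠ j : ℕ in atTop, (((j : ℝ) + 1) ^ n)⁻¹ ≤ |(pairingMatrix (w j) x).det|) :
    IsWellSeparatingCommonComplement k V (Submodule.span ℝ (Set.range x)) := by
  have hli : LinearIndependent ℝ x := linearIndependent_of_det_pairingMatrix_ne_zero (h 0)
  refine ⟨⟨?_, fun j => isCompl_span_of_det_pairingMatrix_ne_zero (hV j) (h j)⟩, ?_⟩
  · change Module.rank ℝ (Submodule.span ℝ (Set.range x)) = k
    have := FiniteDimensional.span_of_finite ℝ (Set.finite_range x)
    rw [← Module.finrank_eq_rank, finrank_span_eq_card hli, Fintype.card_fin]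
  obtain ⟨K, hK, hKle⟩ := exists_abs_det_pairingMatrix_le x
  -- The minimum is eventually the explicit power; the determinant only matters for finitely many j.
  refine ⟨fun j => min (((j : ℝ) + 1) ^ n)⁻¹ |(pairingMatrix (w j) x).det| / K, fun j => ?_,
    fun j => ?_, ?_⟩
  · exact div_pos (lt_min (by positivity) (abs_pos.2 (h j))) hK
  · refine le_trans (ENNReal.ofReal_le_ofReal ?_) (hKle (V j) (w j) (hw j) (hV j))
    exact div_le_div_of_nonneg_right (min_le_right _ _) hK.le
  · refine (tendsto_log_inv_pow_div hK n).congr' ?_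
    filter_upwards [hn] with j hj
    rw [min_eq_left hj]

end Gram

/-! ### Freezing all but one coordinate of a product measure -/

section Resampling

open Measure in
/-- Resampling one coordinate preserves an infinite product measure. -/
theorem map_update_prod_infinitePi {ι : Type*} [DecidableEq ι] {X : ι → Type*}
    [∀ i, MeasurableSpace (X i)] (μ : (i : ι) → Measure (X i)) [∀ i, IsProbabilityMeasure (μ i)]
    (n : ι) :
    ((μ n).prod (infinitePi μ)).map (fun p => Function.update p.2 n p.1) = infinitePi μ := by
  have hm : Measurable fun p : X n × ((i : ι) → X i) => Function.update p.2 n p.1 := by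
    refine measurable_pi_iff.2 fun i => ?_
    by_cases hi : i = n
    · subst hi
      simpa using measurable_fst
    · simp only [Function.update_of_ne hi]
      fun_prop
  refine eq_infinitePi _ fun s t ht => ?_
  rw [map_apply hm (MeasurableSet.pi s.countable_toSet fun i _ => ht i)]
  by_cases hn : n ∈ s
  · have hpre : (fun p : X n × ((i : ι) → X i) => Function.update p.2 n p.1) ⁻¹' Set.pi s t
        = t n ×ˢ Set.pi (s.erase n : Finset ι) t := by
      ext p
      simp only [Set.mem_preimage, Set.mem_pi, Set.mem_prod, Finset.coe_erase, Set.mem_sdiff,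
        Finset.mem_coe, Set.mem_singleton_iff]
      constructor
      · refine fun h => ⟨by simpa using h n hn, fun i hi => ?_⟩
        simpa [Function.update_of_ne hi.2] using h i hi.1
      · rintro ⟨h1, h2⟩ i hi
        by_cases hin : i = n
        · subst hin
          simpa using h1
        · simpa [Function.update_of_ne hin] using h2 i ⟨hi, hin⟩
    rw [hpre, prod_prod, infinitePi_pi μ fun i _ => ht i,
      Finset.mul_prod_erase s (fun i => μ i (t i)) hn]
  · have hpre : (fun p : X n × ((i : ι) → X i) => Function.update p.2 n p.1) ⁻¹' Set.pi s t
        = Set.univ ×ˢ Set.pi s t := by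
      ext p
      simp only [Set.mem_preimage, Set.mem_pi, Set.mem_prod, Set.mem_univ, true_and, Finset.mem_coe]
      refine forall₂_congr fun i hi => ?_
      rw [Function.update_of_ne (ne_of_mem_of_not_mem hi hn)]
    rw [hpre, prod_prod, infinitePi_pi μ fun i _ => ht i, measure_univ, one_mul]

open Measure in
/-- A set has small product measure if its sections in one coordinate are uniformly small. -/
theorem infinitePi_le_of_forall_update_le {ι : Type*} [DecidableEq ι] {X : ι → Type*}
    [∀ i, MeasurableSpace (X i)] (μ : (i : ι) → Measure (X i)) [∀ i, IsProbabilityMeasure (μ i)]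
    (n : ι) {S : Set ((i : ι) → X i)} (hS : MeasurableSet S) {c : ℝ≥0∞}
    (h : ∀ t, μ n {s | Function.update t n s ∈ S} ≤ c) : infinitePi μ S ≤ c := by
  have hm : Measurable fun p : X n × ((i : ι) → X i) => Function.update p.2 n p.1 := by
    refine measurable_pi_iff.2 fun i => ?_
    by_cases hi : i = n
    · subst hi
      simpa using measurable_fst
    · simp only [Function.update_of_ne hi]
      fun_prop
  rw [← map_update_prod_infinitePi μ n, map_apply hm hS, prod_apply_symm (hm hS)]
  calc ∫⁻ t, μ n ((fun s => (s, t)) ⁻¹' ((fun p : X n × ((i : ι) → X i) =>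
          Function.update p.2 n p.1) ⁻¹' S)) ∂infinitePi μ
      ≤ ∫⁻ _, c ∂infinitePi μ := lintegral_mono fun t => h t
    _ = c := by rw [lintegral_const, measure_univ, mul_one]

end Resampling

/-! ### A random direction with nondegenerate pairings -/

section RandomSeries

variable {H : Type*} [NormedAddCommGroup H] [InnerProductSpace ℝ H] {k : ℕ}

theorem summable_inv_succ_sq : Summable fun n : ℕ => (((n : ℝ) + 1) ^ 2)⁻¹ := by
  simpa using (summable_nat_add_iff 1).2 (Real.summable_nat_pow_inv.2 one_lt_two)

/-- The random series `∑ tₙ wₙ / (n + 1)²` with coefficients in the unit interval. -/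
noncomputable def randomSeries (w : ℕ → Fin k → H) (t : ℕ → unitInterval) : Fin k → H :=
  ∑' n, ((t n : ℝ) * (((n : ℝ) + 1) ^ 2)⁻¹) • w n

variable {w : ℕ → Fin k → H}

theorem norm_randomSeries_term_le (hw : ∀ n, Orthonormal ℝ (w n)) (t : ℕ → unitInterval) (n : ℕ) :
    ‖((t n : ℝ) * (((n : ℝ) + 1) ^ 2)⁻¹) • w n‖ ≤ (((n : ℝ) + 1) ^ 2)⁻¹ := by
  have h1 : ‖w n‖ ≤ 1 := (pi_norm_le_iff_of_nonneg zero_le_one).2 fun i => ((hw n).1 i).le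
  have h2 : (0 : ℝ) ≤ (((n : ℝ) + 1) ^ 2)⁻¹ := by positivity
  rw [norm_smul, Real.norm_eq_abs, abs_mul, abs_of_nonneg (t n).2.1, abs_of_nonneg h2]
  calc (t n : ℝ) * (((n : ℝ) + 1) ^ 2)⁻¹ * ‖w n‖ ≤ 1 * (((n : ℝ) + 1) ^ 2)⁻¹ * 1 := by
        gcongr
        exact (t n).2.2
    _ = _ := by ring

theorem continuous_randomSeries [CompleteSpace H] (hw : ∀ n, Orthonormal ℝ (w n)) :
    Continuous (randomSeries w) :=
  continuous_tsum (fun n => by fun_prop) summable_inv_succ_sq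
    fun n t => norm_randomSeries_term_le hw t n

/-- This exhibits the line in `s` to which the determinant estimate applies. -/
theorem randomSeries_update [CompleteSpace H] (hw : ∀ n, Orthonormal ℝ (w n))
    (t : ℕ → unitInterval) (n : ℕ) (s : unitInterval) :
    randomSeries w (Function.update t n s)
      = randomSeries w (Function.update t n 0) + (s : ℝ) • (((n : ℝ) + 1) ^ 2)⁻¹ • w n := by
  have hs : ∀ t : ℕ → unitInterval,
      Summable fun n => ((t n : ℝ) * (((n : ℝ) + 1) ^ 2)⁻¹) • w n := fun t =>
    Summable.of_norm_bounded summable_inv_succ_sq (norm_randomSeries_term_le hw t)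
  rw [← sub_eq_iff_eq_add', randomSeries, randomSeries, ← (hs _).tsum_sub (hs _),
    tsum_eq_single n]
  · simp [mul_smul]
  · intro m hm
    simp [Function.update_of_ne hm]

/-- There is a family of `k` vectors whose pairing with each of countably many orthonormal families
is quantitatively nondegenerate. -/
theorem exists_det_pairingMatrix_ge [CompleteSpace H] (hw : ∀ n, Orthonormal ℝ (w n)) :
    ∃ c : Fin k → H, (∀ j, (pairingMatrix (w j) c).det ≠ 0) ∧
      ∀ᶠ j : ℕ in atTop, (((j : ℝ) + 1) ^ (4 * k))⁻¹ ≤ |(pairingMatrix (w j) c).det| := by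
  have hcont : ∀ j, Continuous fun t => (pairingMatrix (w j) (randomSeries w t)).det := fun j =>
    (continuous_det_pairingMatrix (w j)).comp (continuous_randomSeries hw)
  have key := ae_ne_zero_and_eventually_le
    (Measure.infinitePi fun _ : ℕ => (volume : Measure unitInterval)) (k := k) (m := 2 * k)
    (n := 4 * k) (by omega) (f := fun j t => (pairingMatrix (w j) (randomSeries w t)).det)
    (ρ := fun j => (((j : ℝ) + 1) ^ (2 * k))⁻¹) (fun j => by positivity)
    (Eventually.of_forall fun j => le_rfl) (C := 2 * k) fun j ε hε => ?_
  · obtain ⟨t, ht⟩ := key.exists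
    exact ⟨randomSeries w t, ht⟩
  · refine infinitePi_le_of_forall_update_le _ j
      (measurableSet_lt (hcont j).abs.measurable measurable_const) fun t => ?_
    refine le_trans ?_ (volume_abs_det_add_smul_lt_le
      (pairingMatrix (w j) (randomSeries w (Function.update t j 0)))
      (pairingMatrix (w j) ((((j : ℝ) + 1) ^ 2)⁻¹ • w j)) hε.le)
    rw [unitInterval.volume_apply]
    refine measure_mono ?_
    rintro _ ⟨s, hs, rfl⟩
    have hdet : |(pairingMatrix (w j) ((((j : ℝ) + 1) ^ 2)⁻¹ • w j)).det|
        = (((j : ℝ) + 1) ^ (2 * k))⁻¹ := by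
      rw [pairingMatrix_smul, pairingMatrix_self (hw j), Matrix.det_smul, Matrix.det_one, mul_one,
        Fintype.card_fin, inv_pow, ← pow_mul, abs_of_nonneg (by positivity)]
    rw [Set.mem_ofPred_eq, ← pairingMatrix_add_smul, ← randomSeries_update hw, hdet]
    exact hs

end RandomSeries

/-! ### Lines as probes; probes and prevalence -/

section Probe

variable {X : Type*} [NormedAddCommGroup X]

theorem compl_image_add_right (E : Set X) (x : X) :
    ((fun y => y + x) '' E)ᶜ = {y | y - x ∉ E} := by
  ext y
  simp [Set.image_add_right, sub_eq_add_neg]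

theorem measurableSet_setOf_sub_notMem {E : Set X} (hE : MeasurableSet[borel X] E) (x : X) :
    MeasurableSet[borel X] {y | y - x ∉ E} := by
  let _ : MeasurableSpace X := borel X
  have : BorelSpace X := ⟨rfl⟩
  exact (continuous_sub_right x).measurable hE.compl

variable [NormedSpace ℝ X]

/-- A line is a probe for a Borel set that it meets almost everywhere, in all translates. -/
theorem probeMeasure_span_singleton_eq_zero {c : X} (hc : c ≠ 0) {A : Set X}
    (hA : MeasurableSet[borel X] A) (h : volume {t : ℝ | t • c ∈ A} = 0) :
    probeMeasure (Submodule.span ℝ {c}) A = 0 := by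
  rw [probeMeasure_apply _ hA]
  let P := Submodule.span ℝ {c}
  let ψ : (Fin (Module.finrank ℝ P) → ℝ) ≃L[ℝ] ℝ :=
    ((Module.finBasis ℝ P).equivFun.symm.trans
      (LinearEquiv.toSpanNonzeroSingleton ℝ X c hc).symm).toContinuousLinearEquiv
  have hψ : ∀ y, ψ y • c = probeParam P y := fun y => by
    have := LinearEquiv.toSpanNonzeroSingleton_symm_apply_smul (R := ℝ) (M := X) (x := c) hc
      ((Module.finBasis ℝ P).equivFun.symm y)
    exact this
  -- Lebesgue measure is carried to a Haar measure on ℝ, so null sets agree.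
  have hac : (volume.map ψ : Measure ℝ) ≪ volume := by
    have : (volume.map ψ : Measure ℝ).IsAddHaarMeasure := ψ.isAddHaarMeasure_map volume
    exact Measure.absolutelyContinuous_isAddHaarMeasure _ _
  have h0 := hac h
  refine le_antisymm ((measure_mono fun y hy => ?_).trans
    ((Measure.le_map_apply ψ.continuous.aemeasurable _).trans h0.le)) zero_le
  change ψ y • c ∈ A
  rw [hψ]
  exact hy

/-- If almost every point of every line in the direction `c` is in the Borel set `E`, then the line
through `c` is a probe for every set that contains `E`. -/
theorem isProbe_span_singleton {c : X} (hc : c ≠ 0) {E F : Set X} (hE : MeasurableSet[borel X] E)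
    (hEF : E ⊆ F) (h : ∀ x : X, ∀ᵐ t : ℝ, x + t • c ∈ E) :
    IsProbe (Submodule.span ℝ {c}) F := by
  refine ⟨E, hE, hEF, fun x => ?_⟩
  rw [compl_image_add_right]
  refine probeMeasure_span_singleton_eq_zero hc (measurableSet_setOf_sub_notMem hE x) ?_
  have := h (-x)
  rw [ae_iff] at this
  simpa [sub_eq_neg_add] using this

/-- A set with a probe is prevalent. -/
theorem IsProbe.isPrevalent {P : Submodule ℝ X} [FiniteDimensional ℝ P] {F : Set X}
    (h : IsProbe P F) : IsPrevalent F := by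
  let _ : MeasurableSpace X := borel X
  have hB : BorelSpace X := ⟨rfl⟩
  obtain ⟨E, hE, hEF, hx⟩ := h
  have hcont : Continuous (probeParam P) := (probeParam P).continuous_of_finiteDimensional
  have hinj : Function.Injective (probeParam P) :=
    P.injective_subtype.comp (Module.finBasis ℝ P).equivFun.symm.injective
  have hK : IsCompact (probeParam P '' Metric.closedBall 0 1) :=
    (isCompact_closedBall _ _).image hcont
  refine ⟨E, hE, hEF, probeMeasure P, ⟨_, hK, ?_⟩, hx⟩
  rw [probeMeasure_apply P hK.measurableSet, Set.preimage_image_eq _ hinj]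
  exact ⟨Metric.measure_closedBall_pos _ _ one_pos, measure_closedBall_lt_top⟩

end Probe

end WellSep

/-! ### The main theorem -/

theorem mainTheorem1 {H : Type*} [NormedAddCommGroup H] [InnerProductSpace ℝ H] [CompleteSpace H]
    (k : ℕ) (V : ℕ → Submodule ℝ H) (hV : ∀ j, V j ∈ WellSep.closedSubspacesOfCodim H k) :
    WellSep.IsPrevalent {x : Fin k → H |
        WellSep.IsWellSeparatingCommonComplement k V (Submodule.span ℝ (Set.range x))} ∧
      ∃ (P : Submodule ℝ (Fin k → H)) (_ : FiniteDimensional ℝ P),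
        WellSep.IsProbe P {x : Fin k → H |
          WellSep.IsWellSeparatingCommonComplement k V (Submodule.span ℝ (Set.range x))} := by
  suffices h : ∃ (P : Submodule ℝ (Fin k → H)) (_ : FiniteDimensional ℝ P),
      WellSep.IsProbe P {x : Fin k → H |
        WellSep.IsWellSeparatingCommonComplement k V (Submodule.span ℝ (Set.range x))} by
    obtain ⟨P, hP, hprobe⟩ := h
    exact ⟨hprobe.isPrevalent, P, hP, hprobe⟩
  choose w hw hwV using fun j => WellSep.exists_orthonormal_of_mem_closedSubspacesOfCodim (hV j)
  obtain ⟨c, hc0, hc⟩ := WellSep.exists_det_pairingMatrix_ge hw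
  -- The exponent is 4k for `c` plus 2k from Borel–Cantelli.
  let E : Set (Fin k → H) := {x | (∀ j, (WellSep.pairingMatrix (w j) x).det ≠ 0) ∧
    ∀ᶠ j : ℕ in atTop, (((j : ℝ) + 1) ^ (6 * k))⁻¹ ≤ |(WellSep.pairingMatrix (w j) x).det|}
  have hEF : E ⊆ {x : Fin k → H |
      WellSep.IsWellSeparatingCommonComplement k V (Submodule.span ℝ (Set.range x))} :=
    fun x hx => WellSep.isWellSeparatingCommonComplement_span hw hwV hx.1 hx.2
  have hE : MeasurableSet[borel (Fin k → H)] E := by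
    let _ : MeasurableSpace (Fin k → H) := borel (Fin k → H)
    have : BorelSpace (Fin k → H) := ⟨rfl⟩
    have hm : ∀ j, Measurable fun x : Fin k → H => (WellSep.pairingMatrix (w j) x).det := fun j =>
      (WellSep.continuous_det_pairingMatrix (w j)).measurable
    have hEeq : E = (⋂ j, {x | (WellSep.pairingMatrix (w j) x).det = 0}ᶜ) ∩
        ⋃ N : ℕ, ⋂ j : ℕ, ⋂ _ : N ≤ j,
          {x | (((j : ℝ) + 1) ^ (6 * k))⁻¹ ≤ |(WellSep.pairingMatrix (w j) x).det|} := by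
      ext x
      simp [E, eventually_atTop]
    rw [hEeq]
    exact (MeasurableSet.iInter fun j => (measurableSet_eq_fun (hm j) measurable_const).compl).inter
      (MeasurableSet.iUnion fun N => MeasurableSet.iInter fun j => MeasurableSet.iInter fun _ =>
        measurableSet_le measurable_const (hm j).abs)
  have hline : ∀ x : Fin k → H, ∀ᵐ t : ℝ, x + t • c ∈ E := fun x =>
    WellSep.ae_ne_zero_and_eventually_le volume (k := k) (m := 4 * k) (n := 6 * k) (by omega)
      (f := fun j (t : ℝ) => (WellSep.pairingMatrix (w j) (x + t • c)).det)
      (ρ := fun j => |(WellSep.pairingMatrix (w j) c).det|) (fun j => abs_pos.2 (hc0 j)) hc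
      (C := 2 * k) fun j ε hε => by
        simp only [WellSep.pairingMatrix_add_smul]
        exact WellSep.volume_abs_det_add_smul_lt_le _ _ hε.le
  -- By `hc0`, this occurs only for `k = 0`; then the zero subspace is the probe.
  by_cases hcz : c = 0
  · have hsub : E = Set.univ := by
      refine Set.eq_univ_of_forall fun x => ?_
      obtain ⟨t, ht⟩ := (hline x).exists
      simpa [hcz] using ht
    refine ⟨⊥, inferInstance, E, hE, hEF, fun x => ?_⟩
    rw [WellSep.compl_image_add_right, hsub]
    simp
  · exact ⟨Submodule.span ℝ {c}, inferInstance, WellSep.isProbe_span_singleton hcz hE hEF hline⟩
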